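/- **Theorem (Compression).** Let $G=(V,E)$ be a finite undirected unweighted graph with $n=|V|$ vertices; parallel edges are allowed, loops are not. A cut is a partition of the vertex set into two nonempty subsets; its value in a weighted graph is the total weight of the edges with endpoints in different subsets (every edge of $G$ has weight $1$). A graph is $k$-connected if each of its cuts has value at least $k$; a $k$-strong component of $G$ is a maximal $k$-connected vertex-induced subgraph; and the strength $k_e$ of an edge $e$ is the maximum $k$ such that some $k$-strong component contains (both endpoints of) $e$. There is an absolute constant $C>0$ such that the following holds for every such $G$ and all real $0<\epsilon<1$ and $d>0$. Put $\rho=\rho_\epsilon=3(d+4)(\ln n)/\epsilon^2$ and, for each edge $e$, $p_e=\min\{1,\rho/k_e\}$. Let $G[p_E]$ be the random weighted graph on $V$ obtained by including each edge $e$ of $G$ independently with probability $p_e$, and giving it weight $1/p_e$ if it is included. Then with probability at least $1-n^{-d}$ both of the following hold: 1. $G[p_E]$ has at most $C\,n\rho$ edges; 2. every cut has value in $G[p_E]$ between $(1-\epsilon)$ and $(1+\epsilon)$ times its value in $G$. -/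

import Mathlib

open MeasureTheory ProbabilityTheory
open scoped Graph

/-- An undirected multigraph together with a real weight on each edge. -/
structure WeightedGraph (α β : Type*) where
  /-- The underlying multigraph. -/
  graph : Graph α β
  /-- The edge weights; only the values on the edges of `graph` matter. -/
  weight : β → ℝ

/-- An unweighted graph, seen as the weighted graph all of whose edges have weight `1`. -/
def Graph.unweighted {α β : Type*} (G : Graph α β) : WeightedGraph α β where
  graph := G
  weight := fun _ => 1

/-- `S` is one side of a cut of `G`, that is, of a partition of the vertices into
two nonempty subsets `S` and `V(G) \ S`. -/
def Graph.IsCut {α β : Type*} (G : Graph α β) (S : Set α) : Prop :=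
  S ⊆ V(G) ∧ S.Nonempty ∧ (V(G) \ S).Nonempty

/-- The edges of `G` with one endpoint in `S` and the other one outside. -/
def Graph.crossingEdges {α β : Type*} (G : Graph α β) (S : Set α) : Set β :=
  {e | ∃ x y, G.IsLink e x y ∧ x ∈ S ∧ y ∉ S}

/-- The value of the cut `(S, V \ S)` in a (finite) weighted graph:
the total weight of the edges with endpoints on different sides. -/
noncomputable def WeightedGraph.cutValue {α β : Type*} (H : WeightedGraph α β)
    (S : Set α) : ℝ :=
  ∑ᶠ e ∈ H.graph.crossingEdges S, H.weight e

/-- An unweighted graph is `k`-connected if the value of each cut is at least `k`. -/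
def Graph.IsKConnected {α β : Type*} (G : Graph α β) (k : ℕ) : Prop :=
  ∀ S : Set α, G.IsCut S → (k : ℝ) ≤ G.unweighted.cutValue S

/-- `X` is the vertex set of a `k`-strong component of `G`: a maximal
`k`-connected vertex-induced subgraph. -/
def Graph.IsStrongComponent {α β : Type*} (G : Graph α β) (k : ℕ) (X : Set α) : Prop :=
  Maximal (fun Y : Set α => Y ⊆ V(G) ∧ (G.induce Y).IsKConnected k) X

/-- The strength `k_e` of an edge `e`: the maximum `k` such that some `k`-strong component
contains `e` (both of its endpoints). Cut values are integers here, so it is enough to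
consider integers `k`. -/
noncomputable def Graph.strength {α β : Type*} (G : Graph α β) (e : β) : ℕ :=
  sSup {k : ℕ | ∃ X : Set α, G.IsStrongComponent k X ∧ e ∈ E(G.induce X)}

/-- The compression factor `ρ_ε = 3 (d + 4) (ln n) / ε²`. -/
noncomputable def compressionFactor (n : ℕ) (d ε : ℝ) : ℝ :=
  3 * (d + 4) * Real.log n / ε ^ 2

/-- The compression probabilities `p_e = min {1, ρ / k_e}`, for `ρ ≥ 0`
(see `coe_compressionProb`). -/
noncomputable def Graph.compressionProb {α β : Type*} (G : Graph α β) (ρ : ℝ) (e : β) :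
    unitInterval :=
  Set.projIcc 0 1 zero_le_one (ρ / G.strength e)

theorem Graph.coe_compressionProb {α β : Type*} (G : Graph α β) {ρ : ℝ} (hρ : 0 ≤ ρ) (e : β) :
    (G.compressionProb ρ e : ℝ) = min 1 (ρ / G.strength e) := by
  have h : 0 ≤ ρ / (G.strength e : ℝ) := by positivity
  simp [Graph.compressionProb, Set.coe_projIcc, h]

/-- The joint law of independent coins, one for each edge of `G`; the coin of `e` shows
`true` (the edge is kept) with probability `p e`. -/
noncomputable def Graph.coinLaw {α β : Type*} (G : Graph α β) (p : β → unitInterval) :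
    Measure (E(G) → Bool) :=
  Measure.infinitePi fun e : E(G) => bernoulliMeasure true false (p e)

/-- The compressed graph `G[p]` for the outcome `ω` of the coins: it has the vertices of `G`
and the edges whose coin shows `true`, the edge `e` having weight `1 / p e`. -/
noncomputable def Graph.compressed {α β : Type*} (G : Graph α β) (p : β → unitInterval)
    (ω : E(G) → Bool) : WeightedGraph α β where
  graph := G.restrict {e | ∃ h : e ∈ E(G), ω ⟨e, h⟩ = true}
  weight := fun e => 1 / (p e : ℝ)

/-!
# Compression of graphs by sampling edges with probabilities inverse to their strengths

Give every edge `e` the weight `1 / k_e`. As `k_e` is the number of thresholds `j ≥ 1` with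
`j ≤ k_e`, both the value of a cut `S` in `G` and its value in the compressed graph are sums over
`j` of the contributions of the sets `D = {e ∈ δ(S) | j ≤ k_e}`, in these weights
(`abs_sum_le_of_layers`). So it suffices that none of the sets `D` deviates by more than the factor
`1 ± ε`. A nonempty `D` has weight `w(D) ≥ 1` (`Graph.one_le_sum_inv_strength`), and the Chernoff
bound `measureReal_deviation_le` shows that it deviates with probability at most
`2 exp (-ε² ρ w(D) / 3) = 2 n ^ (-(d + 4) w(D))`.

For a fixed `j`, the sets `D` are the cuts of the graph formed by the edges of strength at least
`j`. Karger's contraction argument bounds the number of cuts of each weight. It is used here in an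
integrated form, `sum_exp_cutSets_le`, which bounds the sum of `exp (-t w(D))` over all cuts `D`
directly, and which does not require the graph to be connected. For `t = (d + 4) ln n` the sum is at
most `(3 / 4) n ^ (-(d + 2))`. Only the values `j` that are strengths of edges matter, and there are
at most `n (n - 1) / 2` of them, since parallel edges have equal strengths
(`Graph.card_strength_le`). By the union bound the cuts fail with probability at most
`(3 / 4) n ^ (-d)`.

The expected number of edges kept is at most `ρ ∑ 1 / k_e ≤ ρ n`, by splitting the graph recursively
along minimum cuts (`Graph.sum_inv_strength_le`), and the exponential Markov inequality
`measureReal_count_le` shows that `3 n ρ` is exceeded with probability at most `n ^ (-d) / 4`.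
-/

/-! ### Counting weighted cuts by contraction -/

section CutCounting

open Finset

variable {V E : Type*}

/-- The edges of `F` that cross the two-colouring `f` of the vertices, where the edge `e` has the
endpoints `a e` and `b e`. -/
def crossing (a b : E → V) (F : Finset E) (f : V → Bool) : Finset E :=
  F.filter fun e => f (a e) ≠ f (b e)

theorem mem_crossing {a b : E → V} {F : Finset E} {f : V → Bool} {e : E} :
    e ∈ crossing a b F f ↔ e ∈ F ∧ f (a e) ≠ f (b e) := by
  simp [crossing]

/-- The total weight of the non-loop edges is at least half the number of vertices when every
vertex has incident edges of total weight at least one. -/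
theorem card_le_two_mul_weight [Fintype V] [DecidableEq V] (a b : E → V) (F : Finset E) (w : E → ℝ)
    (h : ∀ v, 1 ≤ ∑ e ∈ crossing a b F (fun x => decide (x = v)), w e) :
    (Fintype.card V : ℝ) ≤ 2 * ∑ e ∈ F with a e ≠ b e, w e := by
  have h1 : (Fintype.card V : ℝ) ≤ ∑ v : V, ∑ e ∈ crossing a b F (fun x => decide (x = v)), w e := by
    simpa using card_nsmul_le_sum univ _ (1 : ℝ) fun v _ => h v
  refine h1.trans_eq ?_
  simp only [crossing, sum_filter]
  rw [sum_comm, mul_sum]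
  refine sum_congr rfl fun e _ => ?_
  split_ifs with hab
  · have : ∀ x : V, (if decide (a e = x) ≠ decide (b e = x) then w e else 0) =
        (if a e = x then w e else 0) + (if b e = x then w e else 0) := by
      intro x
      by_cases h1 : a e = x <;> by_cases h2 : b e = x <;> simp_all
    simp_rw [this, sum_add_distrib, sum_ite_eq, mem_univ, if_true]
    ring
  · simp_all

variable [DecidableEq E]

/-- The nonempty sets of edges of `F` that cross some two-colouring of the vertices. They are
counted as edge sets, so that the colourings of a disconnected graph that differ by swapping the
colours of a connected component count only once. -/
def cutSets [Fintype V] [DecidableEq V] (a b : E → V) (F : Finset E) : Finset (Finset E) :=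
  (univ.image (crossing a b F)).erase ∅

theorem mem_cutSets [Fintype V] [DecidableEq V] {a b : E → V} {F D : Finset E} :
    D ∈ cutSets a b F ↔ D ≠ ∅ ∧ ∃ f, crossing a b F f = D := by
  simp [cutSets]

/-- The map that merges the vertex `v` into the vertex `u`. -/
def mergeInto [DecidableEq V] {u v : V} (huv : u ≠ v) (x : V) : {x : V // x ≠ v} :=
  if h : x = v then ⟨u, huv⟩ else ⟨x, h⟩

/-- The cuts of the graph in which `v` is merged into `u` are the cuts that do not separate
`u` from `v`. -/
theorem mem_cutSets_mergeInto [Fintype V] [DecidableEq V] {a b : E → V} {F D : Finset E}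
    {u v : V} (huv : u ≠ v) :
    D ∈ cutSets (mergeInto huv ∘ a) (mergeInto huv ∘ b) F ↔
      D ≠ ∅ ∧ ∃ f : V → Bool, f u = f v ∧ crossing a b F f = D := by
  rw [mem_cutSets]
  refine and_congr_right fun _ => ⟨?_, ?_⟩
  · rintro ⟨g, rfl⟩
    refine ⟨g ∘ mergeInto huv, ?_, rfl⟩
    simp [mergeInto, huv]
  · rintro ⟨f, hf, rfl⟩
    refine ⟨fun x => f x, ?_⟩
    have key : ∀ x, f (mergeInto huv x) = f x := by
      intro x
      unfold mergeInto
      split_ifs with h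
      · rw [h, hf]
      · rfl
    simp [crossing, key]

/-- Contracting an edge keeps exactly the cuts that avoid this edge. -/
theorem cutSets_contract [Fintype V] [DecidableEq V] {a b : E → V} {F : Finset E} {e : E}
    (he : e ∈ F) (hab : a e ≠ b e) :
    cutSets (mergeInto hab ∘ a) (mergeInto hab ∘ b) F = (cutSets a b F).filter (e ∉ ·) := by
  ext D
  rw [mem_cutSets_mergeInto, mem_filter, mem_cutSets]
  constructor
  · rintro ⟨h0, f, hf, rfl⟩
    exact ⟨⟨h0, f, rfl⟩, by simp [mem_crossing, hf]⟩
  · rintro ⟨⟨h0, f, rfl⟩, h⟩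
    refine ⟨h0, f, ?_, rfl⟩
    simpa [mem_crossing, he] using h

/-- Merging a vertex without incident (non-loop) edges into another one changes no cut. -/
theorem cutSets_merge_isolated [Fintype V] [DecidableEq V] {a b : E → V} {F : Finset E} {u v : V}
    (huv : u ≠ v) (hv : crossing a b F (fun x => decide (x = v)) = ∅) :
    cutSets (mergeInto huv ∘ a) (mergeInto huv ∘ b) F = cutSets a b F := by
  ext D
  rw [mem_cutSets_mergeInto, mem_cutSets]
  refine and_congr_right fun _ => ⟨fun ⟨f, _, hf⟩ => ⟨f, hf⟩, ?_⟩
  rintro ⟨f, rfl⟩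
  refine ⟨Function.update f v (f u), by simp [huv], ?_⟩
  ext e
  rw [mem_crossing, mem_crossing]
  refine and_congr_right fun he => ?_
  have h : e ∉ crossing a b F (fun x => decide (x = v)) := by simp [hv]
  rw [mem_crossing] at h
  by_cases h1 : a e = v <;> by_cases h2 : b e = v <;> simp_all [Function.update]

/-- A graph with `n + 1` vertices has at most `2 ^ n - 1` cuts. -/
theorem card_cutSets_le [Fintype V] [DecidableEq V] (a b : E → V) (F : Finset E) {n : ℕ}
    (hn : Fintype.card V = n + 1) : (cutSets a b F).card ≤ 2 ^ n - 1 := by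
  obtain ⟨r⟩ : Nonempty V := Fintype.card_pos_iff.1 (by omega)
  -- Swapping the two colours, one may assume that `r` has the colour `false`.
  let ext : ({x : V // x ≠ r} → Bool) → V → Bool := fun g x => if h : x = r then false else g ⟨x, h⟩
  have hsub : cutSets a b F ⊆
      ((univ : Finset ({x : V // x ≠ r} → Bool)).erase fun _ => false).image
        (fun g => crossing a b F (ext g)) := by
    intro D hD
    obtain ⟨h0, f, rfl⟩ := mem_cutSets.1 hD
    rw [mem_image]
    have hcr : crossing a b F (ext fun x => xor (f r) (f x)) = crossing a b F f := by
      have : ∀ x, ext (fun x => xor (f r) (f x)) x = xor (f r) (f x) := by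
        intro x
        by_cases h : x = r <;> simp [ext, h]
      simp [crossing, this]
    refine ⟨fun x => xor (f r) (f x), ?_, hcr⟩
    simp only [mem_erase, mem_univ, and_true]
    intro h
    apply h0
    rw [← hcr, h]
    simp [crossing, ext]
  refine (card_le_card hsub).trans (card_image_le.trans ?_)
  rw [card_erase_of_mem (mem_univ _), card_univ, Fintype.card_fun, Fintype.card_bool]
  simp [Fintype.card_subtype_compl, hn]

/-- The bound for graphs with `n` vertices in `sum_exp_cutSets_le`. It satisfies with equality the
differential recursion (`hasDerivAt_cutBound`) that the contraction argument yields for a graph of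
total weight `n / 2`, such as the cycle with edges of weight `1 / 2`. -/
noncomputable def cutBound (n : ℕ) (t : ℝ) : ℝ :=
  (1 + Real.exp (-t / 2)) ^ n - 1 - n * Real.exp (-t / 2)

theorem cutBound_le_succ (n : ℕ) (t : ℝ) : cutBound n t ≤ cutBound (n + 1) t := by
  have hy : 0 < Real.exp (-t / 2) := Real.exp_pos _
  have h : 1 ≤ (1 + Real.exp (-t / 2)) ^ n := one_le_pow₀ (by linarith)
  unfold cutBound
  push_cast
  rw [pow_succ]
  nlinarith

theorem hasDerivAt_cutBound (n : ℕ) (t : ℝ) :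
    HasDerivAt (cutBound (n + 1))
      (-((n + 1 : ℝ) / 2) * (cutBound (n + 1) t - cutBound n t)) t := by
  have hy : HasDerivAt (fun t : ℝ => Real.exp (-t / 2)) (Real.exp (-t / 2) * (-1 / 2)) t :=
    ((hasDerivAt_id t).neg.div_const 2).exp
  have := (((hy.const_add 1).pow (n + 1)).sub_const 1).sub (hy.const_mul ((n + 1 : ℕ) : ℝ))
  refine this.congr_deriv ?_
  unfold cutBound
  push_cast
  ring

/-- A quantitative form of Karger's cut counting theorem: if all (nonempty) cuts of a graph with
`N = n + 1` vertices have weight at least one, then the sum of `exp (-t w(D))` over the cuts `D` is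
at most `(1 + y) ^ N - 1 - N y`, where `y = exp (-t / 2)`.

After multiplication by `exp (W t)`, where `W` is the total weight, the derivative in `t` of the
left side is the sum over the edges `e` of `w e` times the left side for the graph in which `e` is
contracted. The right side grows at least as fast because `W ≥ N / 2`. -/
theorem sum_exp_cutSets_le (n : ℕ) {V : Type*} [Fintype V] [DecidableEq V]
    (hV : Fintype.card V = n + 1) (a b : E → V) (F : Finset E) (w : E → ℝ) (hw : ∀ e, 0 ≤ w e)
    (h1 : ∀ D ∈ cutSets a b F, 1 ≤ ∑ e ∈ D, w e) {t : ℝ} (ht : 0 ≤ t) :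
    ∑ D ∈ cutSets a b F, Real.exp (-t * ∑ e ∈ D, w e) ≤ cutBound (n + 1) t := by
  induction n generalizing V t with
  | zero =>
    have := card_cutSets_le a b F hV
    have h0 : cutSets a b F = ∅ := by simpa using this
    simp [h0, cutBound]
  | succ n ih =>
    have hcard : ∀ v : V, Fintype.card {x : V // x ≠ v} = n + 1 := by
      intro v
      simp [Fintype.card_subtype_compl, hV]
    -- An isolated vertex is merged into another one; otherwise all stars of vertices are cuts.
    by_cases hiso : ∃ v, crossing a b F (fun x => decide (x = v)) = ∅
    · obtain ⟨v, hv⟩ := hiso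
      obtain ⟨u, huv⟩ := Fintype.exists_ne_of_one_lt_card (by omega) v
      have hc := cutSets_merge_isolated huv hv
      refine le_trans ?_ (cutBound_le_succ (n + 1) t)
      rw [← hc]
      exact ih (hcard v) _ _ (by rwa [hc]) ht
    push Not at hiso
    have hstar : ∀ v, 1 ≤ ∑ e ∈ crossing a b F (fun x => decide (x = v)), w e := fun v =>
      h1 _ (mem_cutSets.2 ⟨(hiso v).ne_empty, _, rfl⟩)
    set F' := F.filter fun e => a e ≠ b e with hF'
    set W := ∑ e ∈ F', w e with hW
    have hWn : ((n + 1 + 1 : ℕ) : ℝ) ≤ 2 * W := by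
      rw [← hV]
      exact card_le_two_mul_weight a b F w hstar
    set Z : ℝ → ℝ := fun t => ∑ D ∈ cutSets a b F, Real.exp (-t * ∑ e ∈ D, w e) with hZ
    have hsub : ∀ D ∈ cutSets a b F, D ⊆ F' := by
      intro D hD e he
      obtain ⟨-, f, rfl⟩ := mem_cutSets.1 hD
      rw [mem_crossing] at he
      exact mem_filter.2 ⟨he.1, fun h => he.2 (by rw [h])⟩
    have hZd : ∀ t, HasDerivAt Z
        (∑ D ∈ cutSets a b F, Real.exp (-t * ∑ e ∈ D, w e) * (-∑ e ∈ D, w e)) t := by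
      intro t
      refine HasDerivAt.fun_sum fun D _ => ?_
      have := ((hasDerivAt_id t).neg.mul_const (∑ e ∈ D, w e)).exp
      simpa using this
    have hcontract : ∀ t, 0 ≤ t →
        W * Z t + ∑ D ∈ cutSets a b F, Real.exp (-t * ∑ e ∈ D, w e) * (-∑ e ∈ D, w e) ≤
          W * cutBound (n + 1) t := by
      intro t ht
      -- Here `W - w(D)` is the total weight of the edges whose contraction keeps the cut `D`.
      have e1 : W * Z t + ∑ D ∈ cutSets a b F, Real.exp (-t * ∑ e ∈ D, w e) * (-∑ e ∈ D, w e) =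
          ∑ e ∈ F', w e * ∑ D ∈ (cutSets a b F).filter (e ∉ ·),
            Real.exp (-t * ∑ e ∈ D, w e) := by
        simp only [hZ, mul_sum, sum_filter]
        rw [sum_comm, ← sum_add_distrib]
        refine sum_congr rfl fun D hD => ?_
        have : W = ∑ e ∈ F', (if e ∉ D then w e else 0) + ∑ e ∈ D, w e := by
          rw [hW, ← sum_sdiff (hsub D hD), ← sum_filter, sdiff_eq_filter]
        have h2 : ∀ x : ℝ, ∑ e ∈ F', w e * (if e ∉ D then x else 0) =
            (∑ e ∈ F', (if e ∉ D then w e else 0)) * x := by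
          intro x
          rw [sum_mul]
          refine sum_congr rfl fun e _ => ?_
          split_ifs <;> simp
        rw [h2, this]
        ring
      rw [e1, hW, sum_mul]
      refine sum_le_sum fun e he => mul_le_mul_of_nonneg_left ?_ (hw e)
      rw [hF', mem_filter] at he
      rw [← cutSets_contract he.1 he.2]
      refine ih (hcard _) _ _ (fun D hD => h1 D ?_) ht
      rw [cutSets_contract he.1 he.2] at hD
      exact (mem_filter.1 hD).1
    set H : ℝ → ℝ := fun t => Real.exp (t * W) * (cutBound (n + 1 + 1) t - Z t) with hH
    have hHd : ∀ t, HasDerivAt H (Real.exp (t * W) * W * (cutBound (n + 1 + 1) t - Z t) +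
        Real.exp (t * W) *
          (-(((n + 1 : ℕ) + 1 : ℝ) / 2) * (cutBound (n + 1 + 1) t - cutBound (n + 1) t) -
            ∑ D ∈ cutSets a b F, Real.exp (-t * ∑ e ∈ D, w e) * (-∑ e ∈ D, w e))) t := by
      intro t
      have hexp : HasDerivAt (fun t : ℝ => Real.exp (t * W)) (Real.exp (t * W) * W) t := by
        simpa using ((hasDerivAt_id t).mul_const W).exp
      exact hexp.mul ((hasDerivAt_cutBound (n + 1) t).sub (hZd t))
    have hmono : MonotoneOn H (Set.Ici 0) := by
      refine monotoneOn_of_deriv_nonneg (convex_Ici 0)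
        (fun t _ => (hHd t).continuousAt.continuousWithinAt)
        (fun t _ => (hHd t).differentiableAt.differentiableWithinAt) fun t ht => ?_
      rw [interior_Ici] at ht
      rw [(hHd t).deriv, mul_assoc, ← mul_add]
      refine mul_nonneg (Real.exp_pos _).le ?_
      have h2 := hcontract t (Set.mem_Ioi.1 ht).le
      have h3 := cutBound_le_succ (n + 1) t
      push_cast at hWn h2 ⊢
      nlinarith
    -- At `t = 0` the claim is a bound for the number of cuts.
    have hH0 : 0 ≤ H 0 := by
      have hc := card_cutSets_le a b F hV
      have h4 : (n + 1) + 1 ≤ 2 ^ (n + 1) := Nat.lt_two_pow_self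
      have h5 : ((cutSets a b F).card : ℝ) ≤ 2 ^ (n + 1) - 1 := by
        have : (cutSets a b F).card + 1 ≤ 2 ^ (n + 1) := by omega
        have : ((cutSets a b F).card : ℝ) + 1 ≤ 2 ^ (n + 1) := by exact_mod_cast this
        linarith
      have h6 : ((n : ℝ) + 1) + 1 ≤ 2 ^ (n + 1) := by exact_mod_cast h4
      simp only [hH, hZ, cutBound]
      norm_num
      rw [pow_succ (2 : ℝ) (n + 1)]
      linarith
    have hHt : 0 ≤ H t := hH0.trans (hmono (Set.mem_Ici.2 le_rfl) (Set.mem_Ici.2 ht) ht)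
    have := nonneg_of_mul_nonneg_right hHt (Real.exp_pos (t * W))
    simp only [hZ] at this
    linarith

end CutCounting

/-! ### Concentration of sums of independent coins -/

section Chernoff

variable {ι : Type*} [Fintype ι]

theorem exp_le_of_abs_le {s : ℝ} (hs : |s| ≤ 2 / 3) : Real.exp s ≤ 1 + s + 3 / 4 * s ^ 2 := by
  have h := (abs_le.1 (Real.exp_bound (x := s) (by linarith) (n := 3) (by norm_num))).2
  simp only [Finset.sum_range_succ, Finset.sum_range_zero, Nat.factorial] at h
  norm_num at h
  have h3 : |s| ^ 3 ≤ 2 / 3 * s ^ 2 := by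
    rw [pow_succ', ← sq_abs s]
    gcongr
  nlinarith [sq_nonneg s]

theorem integral_prod_bernoulliMeasure (p : ι → unitInterval) (φ : ι → Bool → ℝ) :
    ∫ ω, ∏ e, φ e (ω e) ∂(Measure.infinitePi fun e => bernoulliMeasure true false (p e)) =
      ∏ e, ((p e : ℝ) * φ e true + (1 - p e) * φ e false) := by
  rw [Measure.infinitePi_eq_pi, integral_fintype_prod_eq_prod]
  refine Finset.prod_congr rfl fun e _ => ?_
  rw [integral_bernoulliMeasure]
  simp

/-- The centred sum of independent coins, scaled to have mean `m e` each, has a sub-Gaussian moment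
generating function near zero. A coin with `m e < 1` is scaled by `1`, and one with `1 ≤ m e` is
constant; so no upper bound on the `m e` is needed. -/
theorem integral_exp_centered_le (p : ι → unitInterval) (m : ι → ℝ) (hm : ∀ e, 0 < m e)
    (hp : ∀ e, (p e : ℝ) = min 1 (m e)) (D : Finset ι) {s : ℝ} (hs : |s| ≤ 2 / 3) :
    ∫ ω, Real.exp (s * (∑ e ∈ D, m e / p e * (if ω e = true then 1 else 0) - ∑ e ∈ D, m e))
        ∂(Measure.infinitePi fun e => bernoulliMeasure true false (p e)) ≤
      Real.exp (3 / 4 * s ^ 2 * ∑ e ∈ D, m e) := by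
  classical
  have h1 : ∀ ω : ι → Bool,
      Real.exp (s * (∑ e ∈ D, m e / p e * (if ω e = true then 1 else 0) - ∑ e ∈ D, m e)) =
      ∏ e, if e ∈ D then Real.exp (s * (m e / p e * (if ω e = true then 1 else 0) - m e))
        else 1 := by
    intro ω
    rw [Finset.prod_ite_mem, Finset.univ_inter, ← Real.exp_sum, ← Finset.mul_sum,
      Finset.sum_sub_distrib]
  simp_rw [h1]
  rw [integral_prod_bernoulliMeasure p fun e c => if e ∈ D then
    Real.exp (s * (m e / p e * (if c = true then 1 else 0) - m e)) else 1]
  have h2 : Real.exp (3 / 4 * s ^ 2 * ∑ e ∈ D, m e) =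
      ∏ e, if e ∈ D then Real.exp (3 / 4 * s ^ 2 * m e) else 1 := by
    rw [Finset.prod_ite_mem, Finset.univ_inter, ← Real.exp_sum, ← Finset.mul_sum]
  rw [h2]
  refine Finset.prod_le_prod (fun e _ => ?_) fun e _ => ?_
  · have h0 := (p e).2.1
    have h1 := (p e).2.2
    have : 0 ≤ 1 - (p e : ℝ) := by linarith
    positivity
  · by_cases he : e ∈ D
    · simp only [he, if_true, mul_one, Bool.false_eq_true, if_false, mul_zero, zero_sub]
      rcases le_total 1 (m e) with h | h
      · have hp1 : (p e : ℝ) = 1 := by rw [hp, min_eq_left h]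
        rw [hp1]
        simp only [div_one, sub_self, mul_zero, Real.exp_zero, zero_mul, add_zero, mul_one]
        exact Real.one_le_exp (by have := hm e; positivity)
      · have hp1 : (p e : ℝ) = m e := by rw [hp, min_eq_right h]
        rw [hp1, div_self (hm e).ne']
        calc m e * Real.exp (s * (1 - m e)) + (1 - m e) * Real.exp (s * -m e)
            = Real.exp (-(s * m e)) * (m e * (Real.exp s - 1) + 1) := by
              rw [show s * (1 - m e) = -(s * m e) + s by ring, Real.exp_add,
                show s * -m e = -(s * m e) by ring]
              ring
          _ ≤ Real.exp (-(s * m e)) * Real.exp (m e * (Real.exp s - 1)) := by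
              gcongr
              exact Real.add_one_le_exp _
          _ ≤ Real.exp (3 / 4 * s ^ 2 * m e) := by
              rw [← Real.exp_add, Real.exp_le_exp]
              nlinarith [exp_le_of_abs_le hs, hm e]
    · simp [he]

/-- The Chernoff bound: a sum of independent coins, scaled to have mean `m e` each, is unlikely to
deviate from its mean by more than the factor `1 ± ε`. -/
theorem measureReal_deviation_le (p : ι → unitInterval) (m : ι → ℝ) (hm : ∀ e, 0 < m e)
    (hp : ∀ e, (p e : ℝ) = min 1 (m e)) (D : Finset ι) {ε : ℝ} (hε : 0 < ε) (hε1 : ε < 1) :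
    (Measure.infinitePi fun e => bernoulliMeasure true false (p e)).real
      {ω | ε * ∑ e ∈ D, m e <
        |∑ e ∈ D, m e / p e * (if ω e = true then 1 else 0) - ∑ e ∈ D, m e|} ≤
      2 * Real.exp (-(ε ^ 2 / 3) * ∑ e ∈ D, m e) := by
  set μ := Measure.infinitePi fun e => bernoulliMeasure true false (p e)
  set M := ∑ e ∈ D, m e
  set Y : (ι → Bool) → ℝ := fun ω => ∑ e ∈ D, m e / p e * (if ω e = true then 1 else 0) - M
  have hsplit : {ω | ε * M < |Y ω|} ⊆ {ω | ε * M ≤ Y ω} ∪ {ω | Y ω ≤ -(ε * M)} := by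
    intro ω hω
    rcases lt_abs.1 (show ε * M < |Y ω| from hω) with h | h
    · exact Or.inl h.le
    · exact Or.inr (show Y ω ≤ -(ε * M) by linarith)
  -- The exponent `2 ε / 3` nearly minimizes the bound and gives exactly the rate `ε ^ 2 / 3`.
  have hU : μ.real {ω | ε * M ≤ Y ω} ≤ Real.exp (-(ε ^ 2 / 3) * M) := by
    refine (measure_ge_le_exp_mul_mgf (t := 2 * ε / 3) (ε * M) (by positivity)
      .of_finite).trans ?_
    have h := integral_exp_centered_le p m hm hp D (s := 2 * ε / 3)
      (by rw [abs_of_pos (by positivity)]; linarith)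
    refine (mul_le_mul_of_nonneg_left h (Real.exp_pos _).le).trans_eq ?_
    rw [← Real.exp_add]
    congr 1
    ring
  have hL : μ.real {ω | Y ω ≤ -(ε * M)} ≤ Real.exp (-(ε ^ 2 / 3) * M) := by
    refine (measure_le_le_exp_mul_mgf (t := -(2 * ε / 3)) (-(ε * M))
      (by linarith) .of_finite).trans ?_
    have h := integral_exp_centered_le p m hm hp D (s := -(2 * ε / 3))
      (by rw [abs_neg, abs_of_pos (by positivity)]; linarith)
    refine (mul_le_mul_of_nonneg_left h (Real.exp_pos _).le).trans_eq ?_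
    rw [← Real.exp_add]
    congr 1
    ring
  calc μ.real {ω | ε * M < |Y ω|}
      ≤ μ.real ({ω | ε * M ≤ Y ω} ∪ {ω | Y ω ≤ -(ε * M)}) := measureReal_mono hsplit
    _ ≤ _ := measureReal_union_le _ _
    _ ≤ 2 * Real.exp (-(ε ^ 2 / 3) * M) := by linarith

/-- The number of coins that show `true` is unlikely to exceed a multiple of its mean. -/
theorem measureReal_count_le (p : ι → unitInterval) (c : ℝ) :
    (Measure.infinitePi fun e => bernoulliMeasure true false (p e)).real
      {ω | c ≤ ∑ e, (if ω e = true then (1 : ℝ) else 0)} ≤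
      Real.exp (2 * ∑ e, (p e : ℝ) - c) := by
  refine (measure_ge_le_exp_mul_mgf (t := 1) c (by norm_num) .of_finite).trans ?_
  have h : mgf (fun ω : ι → Bool => ∑ e, (if ω e = true then (1 : ℝ) else 0))
      (Measure.infinitePi fun e => bernoulliMeasure true false (p e)) 1 ≤
      Real.exp (2 * ∑ e, (p e : ℝ)) := by
    simp only [mgf, one_mul, Real.exp_sum, Finset.mul_sum]
    rw [integral_prod_bernoulliMeasure p fun e c => Real.exp (if c = true then (1 : ℝ) else 0)]
    refine Finset.prod_le_prod (fun e _ => ?_) fun e _ => ?_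
    · have h0 := (p e).2.1
      have : 0 ≤ 1 - (p e : ℝ) := by linarith [(p e).2.2]
      positivity
    · simp only [if_true, Bool.false_eq_true, if_false, Real.exp_zero]
      have h1 := Real.exp_one_lt_d9
      have h2 := Real.add_one_le_exp (2 * (p e : ℝ))
      nlinarith [(p e).2.1]
  refine (mul_le_mul_of_nonneg_left h (Real.exp_pos _).le).trans_eq ?_
  rw [← Real.exp_add]
  congr 1
  ring

end Chernoff

/-! ### Edge strengths -/

theorem sum_union_le {ι : Type*} [DecidableEq ι] {s t : Finset ι} {f : ι → ℝ}
    (hf : ∀ i, 0 ≤ f i) : ∑ i ∈ s ∪ t, f i ≤ ∑ i ∈ s, f i + ∑ i ∈ t, f i := by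
  rw [← Finset.sum_union_inter]
  exact le_add_of_nonneg_right (Finset.sum_nonneg fun i _ => hf i)

namespace Graph

variable {α β : Type*} {G : Graph α β}

theorem IsLink.mem_crossingEdges_iff {e : β} {x y : α} (h : G.IsLink e x y) (S : Set α) :
    e ∈ G.crossingEdges S ↔ ¬(x ∈ S ↔ y ∈ S) := by
  constructor
  · rintro ⟨u, v, huv, hu, hv⟩
    rcases h.eq_and_eq_or_eq_and_eq huv with ⟨rfl, rfl⟩ | ⟨rfl, rfl⟩ <;> simp [hu, hv]
  · intro hxy
    by_cases hx : x ∈ S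
    · exact ⟨x, y, h, hx, fun hy => hxy (iff_of_true hx hy)⟩
    · exact ⟨y, x, h.symm, by_contra fun hy => hxy (iff_of_false hx hy), hx⟩

theorem IsLink.mem_edgeSet_induce_iff {e : β} {x y : α} (h : G.IsLink e x y) (X : Set α) :
    e ∈ E(G.induce X) ↔ x ∈ X ∧ y ∈ X := by
  rw [edgeSet_induce]
  constructor
  · rintro ⟨u, v, huv, hu, hv⟩
    rcases h.eq_and_eq_or_eq_and_eq huv with ⟨rfl, rfl⟩ | ⟨rfl, rfl⟩ <;> simp [hu, hv]
  · exact fun hxy => ⟨x, y, h, hxy⟩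

theorem edgeSet_induce_subset (X : Set α) : E(G.induce X) ⊆ E(G) := by
  rintro e ⟨x, y, h, -⟩
  exact h.edge_mem

theorem edgeSet_induce_mono {X Y : Set α} (h : X ⊆ Y) : E(G.induce X) ⊆ E(G.induce Y) := by
  rintro e ⟨x, y, hl, hx, hy⟩
  exact ⟨x, y, hl, h hx, h hy⟩

theorem crossingEdges_subset (S : Set α) : G.crossingEdges S ⊆ E(G) := by
  rintro e ⟨x, y, h, -⟩
  exact h.edge_mem

theorem cutValue_unweighted (hE : E(G).Finite) (S : Set α) :
    G.unweighted.cutValue S = (G.crossingEdges S).ncard := by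
  have hf : (G.crossingEdges S).Finite := hE.subset (crossingEdges_subset S)
  change ∑ᶠ e ∈ G.crossingEdges S, (1 : ℝ) = _
  rw [finsum_mem_eq_finite_toFinset_sum _ hf, Set.ncard_eq_toFinset_card _ hf]
  simp

theorem isKConnected_iff (hE : E(G).Finite) {k : ℕ} :
    G.IsKConnected k ↔ ∀ S, G.IsCut S → k ≤ (G.crossingEdges S).ncard := by
  simp only [IsKConnected, cutValue_unweighted hE, Nat.cast_le]

theorem exists_isStrongComponent (hV : V(G).Finite) {k : ℕ} {Y : Set α} (hY : Y ⊆ V(G))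
    (hk : (G.induce Y).IsKConnected k) : ∃ X, Y ⊆ X ∧ G.IsStrongComponent k X :=
  (hV.finite_subsets.subset fun _ h => h.1 :
    {Y : Set α | Y ⊆ V(G) ∧ (G.induce Y).IsKConnected k}.Finite).exists_le_maximal ⟨hY, hk⟩

theorem bddAbove_strength (hG : G.Loopless) (hE : E(G).Finite) (e : β) :
    BddAbove {k : ℕ | ∃ X : Set α, G.IsStrongComponent k X ∧ e ∈ E(G.induce X)} := by
  refine ⟨E(G).ncard, ?_⟩
  rintro k ⟨X, hX, x, y, hl, hx, hy⟩
  have hE' := hE.subset (edgeSet_induce_subset (G := G) X)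
  have hcut : (G.induce X).IsCut {x} :=
    ⟨by simpa using hx, by simp, y, hy, fun h => hl.ne (Set.mem_singleton_iff.1 h).symm⟩
  exact ((isKConnected_iff hE').1 hX.prop.2 _ hcut).trans
    (Set.ncard_le_ncard ((crossingEdges_subset _).trans (edgeSet_induce_subset X)) hE)

/-- An edge of a `k`-connected induced subgraph has strength at least `k`. -/
theorem le_strength (hG : G.Loopless) (hV : V(G).Finite) (hE : E(G).Finite) {k : ℕ} {Y : Set α}
    (hY : Y ⊆ V(G)) (hk : (G.induce Y).IsKConnected k) {e : β} (he : e ∈ E(G.induce Y)) :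
    k ≤ G.strength e := by
  obtain ⟨X, hYX, hX⟩ := exists_isStrongComponent hV hY hk
  exact le_csSup (bddAbove_strength hG hE e) ⟨X, hX, edgeSet_induce_mono hYX he⟩

theorem isKConnected_pair (hE : E(G).Finite) {e : β} {x y : α} (h : G.IsLink e x y) :
    (G.induce {x, y}).IsKConnected 1 := by
  have hE' := hE.subset (edgeSet_induce_subset (G := G) {x, y})
  rw [isKConnected_iff hE']
  rintro S ⟨hS, ⟨u, hu⟩, v, hv, hvS⟩
  have hl : (G.induce {x, y}).IsLink e x y := ⟨h, by simp, by simp⟩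
  refine (Set.ncard_pos (hE'.subset (crossingEdges_subset S))).2 ?_
  refine ⟨e, (hl.mem_crossingEdges_iff S).2 fun hiff => ?_⟩
  have hu' : u = x ∨ u = y := hS hu
  have hv' : v = x ∨ v = y := hv
  rcases hu' with rfl | rfl <;> rcases hv' with rfl | rfl <;> tauto

theorem one_le_strength (hG : G.Loopless) (hV : V(G).Finite) (hE : E(G).Finite) {e : β}
    (he : e ∈ E(G)) : 1 ≤ G.strength e := by
  obtain ⟨x, y, h⟩ := exists_isLink_of_mem_edgeSet he
  refine le_strength hG hV hE (Y := {x, y}) ?_ (isKConnected_pair hE h)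
    ((h.mem_edgeSet_induce_iff _).2 (by simp))
  rintro z (rfl | rfl)
  exacts [h.left_mem, h.right_mem]

/-- The maximum in the definition of the strength is attained. -/
theorem exists_isKConnected_strength (hG : G.Loopless) (hV : V(G).Finite) (hE : E(G).Finite)
    {e : β} (he : e ∈ E(G)) :
    ∃ Y ⊆ V(G), (G.induce Y).IsKConnected (G.strength e) ∧ e ∈ E(G.induce Y) := by
  have hne : {k : ℕ | ∃ X : Set α, G.IsStrongComponent k X ∧ e ∈ E(G.induce X)}.Nonempty := by
    obtain ⟨x, y, h⟩ := exists_isLink_of_mem_edgeSet he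
    obtain ⟨X, hYX, hX⟩ := exists_isStrongComponent hV (Y := {x, y})
      (by rintro z (rfl | rfl); exacts [h.left_mem, h.right_mem]) (isKConnected_pair hE h)
    exact ⟨1, X, hX, edgeSet_induce_mono hYX ((h.mem_edgeSet_induce_iff _).2 (by simp))⟩
  obtain ⟨X, hX, heX⟩ := Nat.sSup_mem hne (bddAbove_strength hG hE e)
  exact ⟨X, hX.prop.1, hX.prop.2, heX⟩

theorem strength_eq_of_isLink {e f : β} {x y : α} (he : G.IsLink e x y) (hf : G.IsLink f x y) :
    G.strength e = G.strength f := by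
  simp only [strength, he.mem_edgeSet_induce_iff, hf.mem_edgeSet_induce_iff]

open Classical in
/-- There are at most `n choose 2` different strengths, as the strength of an edge depends
on its two endpoints only. -/
theorem card_strength_le [Fintype V(G)] [Fintype E(G)] (hG : G.Loopless) :
    (Finset.univ.image fun e : E(G) => G.strength e).card ≤ (Fintype.card V(G)).choose 2 := by
  have h : ∀ e : E(G), ∃ z : {z : Sym2 V(G) // ¬z.IsDiag},
      ∀ x y, z.1 = s(x, y) → G.IsLink e x y := by
    intro e
    obtain ⟨x, y, hl⟩ := exists_isLink_of_mem_edgeSet e.2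
    refine ⟨⟨s(⟨x, hl.left_mem⟩, ⟨y, hl.right_mem⟩), ?_⟩, ?_⟩
    · simpa using hl.ne
    · intro u v huv
      rcases Sym2.eq_iff.1 huv with ⟨rfl, rfl⟩ | ⟨rfl, rfl⟩
      exacts [hl, hl.symm]
  choose z hz using h
  rw [← Sym2.card_subtype_not_diag, ← Finset.card_univ]
  have hfac : ∀ e f : E(G), z e = z f → G.strength e = G.strength f := by
    intro e f hef
    obtain ⟨x, y, hxy⟩ : ∃ x y, (z e).1 = s(x, y) := by
      induction (z e).1 with | h x y => exact ⟨x, y, rfl⟩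
    exact strength_eq_of_isLink (hz e x y hxy) (hz f x y (hef ▸ hxy))
  calc (Finset.univ.image fun e : E(G) => G.strength e).card
      ≤ (Finset.univ.image z).card := by
        refine Finset.card_le_card_of_surjOn
          (fun u => if h : ∃ e, z e = u then G.strength h.choose else 0) ?_
        intro k hk
        simp only [Finset.coe_image, Finset.coe_univ, Set.image_univ, Set.mem_range] at hk
        obtain ⟨e, rfl⟩ := hk
        have hex : ∃ f, z f = z e := ⟨e, rfl⟩
        refine ⟨z e, by simp, ?_⟩
        simp only [hex, dif_pos]
        exact hfac _ _ hex.choose_spec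
    _ ≤ _ := Finset.card_le_univ _

open Classical in
/-- Let the edge `e` have the weight `1 / k_e`. A cut that is crossed by some edge of strength at
least `j` is crossed by such edges of total weight at least one: the strongest crossing edge, of
strength `k`, lies in a `k`-connected induced subgraph, and the at least `k` edges of this subgraph
that cross the cut all have strength exactly `k`. -/
theorem one_le_sum_inv_strength (hG : G.Loopless) (hV : V(G).Finite) [Fintype E(G)] {S : Set α}
    {j : ℕ} {e₀ : E(G)} (h0 : (e₀ : β) ∈ G.crossingEdges S) (hj : j ≤ G.strength e₀) :
    1 ≤ ∑ e ∈ Finset.univ.filter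
      (fun e : E(G) => (e : β) ∈ G.crossingEdges S ∧ j ≤ G.strength e),
      1 / (G.strength e : ℝ) := by
  have hE : E(G).Finite := Set.toFinite _
  obtain ⟨e, he, hmax⟩ := Finset.exists_max_image
    (Finset.univ.filter fun e : E(G) => (e : β) ∈ G.crossingEdges S)
    (fun e => G.strength e) ⟨e₀, by simpa using h0⟩
  simp only [Finset.mem_filter, Finset.mem_univ, true_and] at he hmax
  set k := G.strength e
  have hk : 1 ≤ k := one_le_strength hG hV hE e.2
  obtain ⟨Y, hYV, hYk, heY⟩ := exists_isKConnected_strength hG hV hE e.2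
  have hE' := hE.subset (edgeSet_induce_subset (G := G) Y)
  obtain ⟨x, y, hxy, hxS, hyS⟩ := he
  obtain ⟨hxY, hyY⟩ := (hxy.mem_edgeSet_induce_iff Y).1 heY
  have hcut : (G.induce Y).IsCut (S ∩ Y) :=
    ⟨Set.inter_subset_right, ⟨x, hxS, hxY⟩, y, hyY, fun h => hyS h.1⟩
  have hcard := (isKConnected_iff hE').1 hYk _ hcut
  set T : Finset E(G) := Finset.univ.filter fun f => (f : β) ∈ (G.induce Y).crossingEdges (S ∩ Y)
  have hT : k ≤ T.card := by
    refine hcard.trans_eq ?_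
    rw [← Finset.card_map (Function.Embedding.subtype _), ← Set.ncard_coe_finset]
    congr 1
    ext f
    simp only [Finset.coe_map, Set.mem_image, Finset.mem_coe, T, Finset.mem_filter,
      Finset.mem_univ, true_and, Function.Embedding.subtype_apply]
    constructor
    · intro hf
      exact ⟨⟨f, edgeSet_induce_subset Y (crossingEdges_subset _ hf)⟩, hf, rfl⟩
    · rintro ⟨f, hf, rfl⟩
      exact hf
  have hTS : ∀ f ∈ T, (f : β) ∈ G.crossingEdges S ∧ G.strength f = k := by
    intro f hf
    simp only [T, Finset.mem_filter, Finset.mem_univ, true_and] at hf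
    have hfY := crossingEdges_subset _ hf
    obtain ⟨u, v, huv, hu, hv⟩ := hf
    have hfS : (f : β) ∈ G.crossingEdges S := ⟨u, v, huv.1, hu.1, fun h => hv ⟨h, huv.2.2⟩⟩
    exact ⟨hfS, le_antisymm (hmax f hfS) (le_strength hG hV hE hYV hYk hfY)⟩
  calc (1 : ℝ) ≤ T.card * (1 / (k : ℝ)) := by
        rw [mul_one_div, le_div_iff₀ (by positivity), one_mul]
        exact_mod_cast hT
    _ = ∑ f ∈ T, 1 / (G.strength f : ℝ) := by
        rw [Finset.sum_congr rfl fun f hf => by rw [(hTS f hf).2], Finset.sum_const, nsmul_eq_mul]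
    _ ≤ _ := by
        refine Finset.sum_le_sum_of_subset_of_nonneg (fun f hf => ?_) fun _ _ _ => by positivity
        simp only [Finset.mem_filter, Finset.mem_univ, true_and]
        exact ⟨(hTS f hf).1, (hTS f hf).2 ▸ hj.trans (hmax e₀ h0)⟩

open Classical in
/-- The weights `1 / k_e` of the edges of a graph with `m + 1` vertices sum to at most `m`: the
edges of a minimum cut, of value `c`, have strength at least `c`, so they contribute at most one.
Removing them leaves two smaller induced subgraphs. -/
theorem sum_inv_strength_induce_le (hG : G.Loopless) (hV : V(G).Finite) [Fintype E(G)] (m : ℕ)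
    {X : Set α} (hX : X ⊆ V(G)) (hm : X.ncard = m + 1) :
    ∑ e ∈ Finset.univ.filter (fun e : E(G) => (e : β) ∈ E(G.induce X)),
      1 / (G.strength e : ℝ) ≤ m := by
  have hE : E(G).Finite := Set.toFinite _
  induction m using Nat.strong_induction_on generalizing X with
  | _ m ih =>
  have hXf : X.Finite := hV.subset hX
  rcases Nat.eq_zero_or_pos m with rfl | hmpos
  · obtain ⟨v, rfl⟩ := Set.ncard_eq_one.1 hm
    rw [Finset.sum_eq_zero]
    · simp
    · intro e he
      simp only [Finset.mem_filter, Finset.mem_univ, true_and] at he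
      obtain ⟨x, y, hl, hx, hy⟩ := he
      exact absurd (hx.trans hy.symm) hl.ne
  have hcutne : {S | (G.induce X).IsCut S}.Nonempty := by
    obtain ⟨x, hx, y, hy, hxy⟩ := (Set.one_lt_ncard_iff_nontrivial_and_finite.1
      (show 1 < X.ncard by omega)).1
    exact ⟨{x}, by simpa using hx, by simp, y, hy, fun h => hxy (Set.mem_singleton_iff.1 h).symm⟩
  have hcutfin : {S | (G.induce X).IsCut S}.Finite :=
    hXf.finite_subsets.subset fun S hS => hS.1
  obtain ⟨S, hS, hmin⟩ := Set.exists_min_image _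
    (fun S => ((G.induce X).crossingEdges S).ncard) hcutfin hcutne
  obtain ⟨hSX, hSne, hSne'⟩ := hS
  replace hSX : S ⊆ X := hSX
  replace hSne' : (X \ S).Nonempty := hSne'
  set c := ((G.induce X).crossingEdges S).ncard
  have hE' := hE.subset (edgeSet_induce_subset (G := G) X)
  have hconn : (G.induce X).IsKConnected c := (isKConnected_iff hE').2 hmin
  have h1 : 0 < S.ncard := (Set.ncard_pos (hXf.subset hSX)).2 hSne
  have h2 : 0 < (X \ S).ncard := (Set.ncard_pos (hXf.subset Set.sdiff_subset)).2 hSne'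
  have h3 : (X \ S).ncard + S.ncard = X.ncard := Set.ncard_sdiff_add_ncard_of_subset hSX hXf
  have i1 := ih (S.ncard - 1) (by omega) (hSX.trans hX) (by omega)
  have i2 := ih ((X \ S).ncard - 1) (by omega) (X := X \ S) (Set.sdiff_subset.trans hX) (by omega)
  set T : Finset E(G) := Finset.univ.filter fun f => (f : β) ∈ (G.induce X).crossingEdges S
  have hT : T.card = c := by
    rw [← Finset.card_map (Function.Embedding.subtype _), ← Set.ncard_coe_finset]
    congr 1
    ext f
    simp only [Finset.coe_map, Set.mem_image, Finset.mem_coe, T, Finset.mem_filter,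
      Finset.mem_univ, true_and, Function.Embedding.subtype_apply]
    constructor
    · rintro ⟨f, hf, rfl⟩
      exact hf
    · intro hf
      exact ⟨⟨f, edgeSet_induce_subset X (crossingEdges_subset _ hf)⟩, hf, rfl⟩
  have i3 : ∑ e ∈ T, 1 / (G.strength e : ℝ) ≤ 1 := by
    rcases Nat.eq_zero_or_pos c with hc | hc
    · rw [hc, Finset.card_eq_zero] at hT
      simp [hT]
    · have : ∀ e ∈ T, 1 / (G.strength e : ℝ) ≤ 1 / (c : ℝ) := by
        intro e he
        have he' : (e : β) ∈ (G.induce X).crossingEdges S := by simpa [T] using he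
        have hle : c ≤ G.strength e := le_strength hG hV hE hX hconn (crossingEdges_subset _ he')
        exact one_div_le_one_div_of_le (by exact_mod_cast hc) (by exact_mod_cast hle)
      refine (Finset.sum_le_card_nsmul _ _ _ this).trans_eq ?_
      rw [hT, nsmul_eq_mul, mul_one_div, div_self (by positivity)]
  have hsub : (Finset.univ.filter fun e : E(G) => (e : β) ∈ E(G.induce X)) ⊆
      (T ∪ Finset.univ.filter fun e : E(G) => (e : β) ∈ E(G.induce S)) ∪
        Finset.univ.filter fun e : E(G) => (e : β) ∈ E(G.induce (X \ S)) := by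
    intro e he
    simp only [Finset.mem_filter, Finset.mem_univ, true_and, Finset.mem_union, T] at he ⊢
    obtain ⟨x, y, hl⟩ := exists_isLink_of_mem_edgeSet he
    rw [hl.mem_crossingEdges_iff, hl.1.mem_edgeSet_induce_iff, hl.1.mem_edgeSet_induce_iff]
    have := hl.2
    simp only [Set.mem_sdiff]
    tauto
  have hnn : ∀ e : E(G), 0 ≤ 1 / (G.strength e : ℝ) := fun e => by positivity
  have hsum := (Finset.sum_le_sum_of_subset_of_nonneg hsub fun e _ _ => hnn e).trans
    ((sum_union_le hnn).trans
      (add_le_add_left (sum_union_le hnn) _))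
  have hcast : ((S.ncard - 1 : ℕ) : ℝ) + ((X \ S).ncard - 1 : ℕ) + 1 = m := by
    have : S.ncard - 1 + ((X \ S).ncard - 1) + 1 = m := by omega
    exact_mod_cast this
  linarith

theorem sum_inv_strength_le (hG : G.Loopless) (hV : V(G).Finite) [Fintype E(G)]
    (hne : V(G).Nonempty) : ∑ e : E(G), 1 / (G.strength e : ℝ) ≤ V(G).ncard := by
  classical
  have hpos := (Set.ncard_pos hV).2 hne
  have h := sum_inv_strength_induce_le hG hV (V(G).ncard - 1) subset_rfl (by omega)
  rw [Finset.filter_true_of_mem (by simp)] at h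
  exact h.trans (Nat.cast_le.2 (Nat.sub_le _ _))

end Graph

/-! ### The compressed graph -/

/-- The cut of a compressed graph is the sum over the thresholds `j` of the contributions of the
edges of strength at least `j`, each edge having its weight divided by its strength. So it
suffices to control each of these contributions. Here `x` is the relative deviation of the weight
of an edge and `κ` its strength. -/
theorem abs_sum_le_of_layers {ι : Type*} (δ : Finset ι) (κ : ι → ℕ) (hκ : ∀ i, 1 ≤ κ i)
    (x : ι → ℝ) (ε : ℝ)
    (h : ∀ j, |∑ i ∈ δ with j ≤ κ i, x i / κ i| ≤ ε * ∑ i ∈ δ with j ≤ κ i, 1 / (κ i : ℝ)) :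
    |∑ i ∈ δ, x i| ≤ ε * δ.card := by
  have key : ∀ y : ι → ℝ, ∑ i ∈ δ, y i =
      ∑ j ∈ Finset.Icc 1 (δ.sup κ), ∑ i ∈ δ with j ≤ κ i, y i / κ i := by
    intro y
    simp only [Finset.sum_filter]
    rw [Finset.sum_comm]
    refine Finset.sum_congr rfl fun i hi => ?_
    have hle : κ i ≤ δ.sup κ := Finset.le_sup hi
    have hfil : (Finset.Icc 1 (δ.sup κ)).filter (fun j => j ≤ κ i) = Finset.Icc 1 (κ i) := by
      ext j
      simp only [Finset.mem_filter, Finset.mem_Icc]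
      omega
    have hpos : (κ i : ℝ) ≠ 0 := by
      have := hκ i
      positivity
    rw [← Finset.sum_filter, hfil, Finset.sum_const, Nat.card_Icc, nsmul_eq_mul,
      Nat.add_sub_cancel]
    field_simp
  have hcard : (δ.card : ℝ) = ∑ i ∈ δ, (1 : ℝ) := by simp
  rw [hcard, key x, key fun _ => 1, Finset.mul_sum]
  exact (Finset.abs_sum_le_sum_abs _ _).trans (Finset.sum_le_sum fun j _ => h j)

/-- The size of `cutBound` at the failure exponent `t = (d + 4) ln n`. -/
theorem cutBound_le {n : ℕ} (hn : 2 ≤ n) {d : ℝ} (hd : 0 < d) :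
    cutBound n ((d + 4) * Real.log n) ≤ 3 / 4 * Real.exp (-(d + 2) * Real.log n) := by
  have hn0 : (0 : ℝ) < n := by positivity
  have hn2 : (2 : ℝ) ≤ n := by exact_mod_cast hn
  have hlog : 0 ≤ Real.log n := Real.log_nonneg (by linarith)
  unfold cutBound
  set y := Real.exp (-((d + 4) * Real.log n) / 2) with hy
  have hny : n * y = Real.exp (-((d + 2) / 2) * Real.log n) := by
    rw [hy]
    conv_lhs => rw [← Real.exp_log hn0, ← Real.exp_add]
    rw [Real.log_exp]
    congr 1
    ring
  have hsq : (n * y) ^ 2 = Real.exp (-(d + 2) * Real.log n) := by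
    rw [hny, ← Real.exp_nat_mul]
    congr 1
    push_cast
    ring
  have hle : n * y ≤ 1 / 2 := by
    calc n * y ≤ Real.exp (-Real.log n) := by
          rw [hny, Real.exp_le_exp]
          nlinarith
      _ = 1 / n := by rw [Real.exp_neg, Real.exp_log hn0, one_div]
      _ ≤ 1 / 2 := one_div_le_one_div_of_le (by norm_num) hn2
  have hy0 : 0 < y := Real.exp_pos _
  have hpow : (1 + y) ^ n ≤ Real.exp (n * y) := by
    rw [Real.exp_nat_mul]
    gcongr
    linarith [Real.add_one_le_exp y]
  have hexp := exp_le_of_abs_le (s := n * y) (by rw [abs_of_pos (by positivity)]; linarith)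
  rw [← hsq]
  linarith

namespace Graph

variable {α β : Type*} {G : Graph α β}

open Classical in
theorem cutValue_unweighted_eq_card [Fintype E(G)] (S : Set α) :
    G.unweighted.cutValue S =
      (Finset.univ.filter fun e : E(G) => (e : β) ∈ G.crossingEdges S).card := by
  rw [cutValue_unweighted (Set.toFinite _), ← Finset.card_map (Function.Embedding.subtype _),
    ← Set.ncard_coe_finset]
  congr 2
  ext e
  simpa using fun h => crossingEdges_subset S h

open Classical in
theorem cutValue_compressed [Fintype E(G)] (p : β → unitInterval) (ω : E(G) → Bool) (S : Set α) :
    (G.compressed p ω).cutValue S =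
      ∑ e ∈ Finset.univ.filter (fun e : E(G) => (e : β) ∈ G.crossingEdges S),
        1 / (p e : ℝ) * (if ω e = true then 1 else 0) := by
  have hset : (G.compressed p ω).graph.crossingEdges S = Subtype.val ''
      (((Finset.univ.filter fun e : E(G) => (e : β) ∈ G.crossingEdges S).filter
        fun e => ω e = true : Finset E(G)) : Set E(G)) := by
    ext e
    simp only [compressed, Set.mem_image, Finset.coe_filter, Finset.mem_filter, Finset.mem_univ,
      true_and]
    constructor
    · rintro ⟨x, y, ⟨⟨h, hω⟩, hl⟩, hx, hy⟩
      exact ⟨⟨e, h⟩, ⟨⟨x, y, hl, hx, hy⟩, hω⟩, rfl⟩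
    · rintro ⟨f, ⟨⟨x, y, hl, hx, hy⟩, hω⟩, rfl⟩
      exact ⟨x, y, ⟨⟨f.2, hω⟩, hl⟩, hx, hy⟩
  unfold WeightedGraph.cutValue
  rw [hset, finsum_mem_image Subtype.val_injective.injOn, finsum_mem_coe_finset,
    Finset.sum_filter]
  simp [compressed]

theorem ncard_edgeSet_compressed [Fintype E(G)] (p : β → unitInterval) (ω : E(G) → Bool) :
    (E((G.compressed p ω).graph).ncard : ℝ) = ∑ e, (if ω e = true then (1 : ℝ) else 0) := by
  have hset : E((G.compressed p ω).graph) = Subtype.val ''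
      ((Finset.univ.filter fun e : E(G) => ω e = true : Finset E(G)) : Set E(G)) := by
    ext e
    simp only [compressed, edgeSet_restrict, Set.mem_image, Finset.coe_filter, Finset.mem_univ,
      true_and]
    constructor
    · rintro ⟨-, h, hω⟩
      exact ⟨⟨e, h⟩, hω, rfl⟩
    · rintro ⟨f, hω, rfl⟩
      exact ⟨f.2, f.2, hω⟩
  rw [hset, Set.ncard_image_of_injective _ Subtype.val_injective, Set.ncard_coe_finset,
    Finset.card_filter]
  push_cast
  rfl

open Classical in
/-- If none of the sets `{e ∈ δ(S) | j ≤ k_e}` deviates, then the cut `S` does not deviate. -/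
theorem abs_cutValue_compressed_sub_le [Fintype E(G)] (hstr : ∀ e : E(G), 1 ≤ G.strength e)
    {ρ : ℝ} (hρ : 0 < ρ) {ε : ℝ} (p : β → unitInterval) (ω : E(G) → Bool) (S : Set α)
    (h : ∀ j : ℕ, ∀ D : Finset E(G),
      D = Finset.univ.filter (fun e : E(G) => (e : β) ∈ G.crossingEdges S ∧ j ≤ G.strength e) →
      |∑ e ∈ D, ρ / G.strength e / p e * (if ω e = true then 1 else 0)
        - ∑ e ∈ D, ρ / (G.strength e : ℝ)| ≤ ε * ∑ e ∈ D, ρ / (G.strength e : ℝ)) :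
    |(G.compressed p ω).cutValue S - G.unweighted.cutValue S| ≤
      ε * G.unweighted.cutValue S := by
  rw [cutValue_compressed, cutValue_unweighted_eq_card, Finset.cast_card,
    ← Finset.sum_sub_distrib, ← Finset.cast_card]
  refine abs_sum_le_of_layers _ (fun e : E(G) => G.strength e) hstr _ ε fun j => ?_
  have h2 := h j _ rfl
  rw [← Finset.filter_filter, ← Finset.sum_sub_distrib] at h2
  refine le_of_mul_le_mul_left ?_ hρ
  rw [← abs_of_pos hρ, ← abs_mul, abs_of_pos hρ, mul_left_comm, Finset.mul_sum, Finset.mul_sum]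
  refine (congrArg abs (Finset.sum_congr rfl fun e _ => ?_)).trans_le
    (h2.trans_eq (congrArg _ (Finset.sum_congr rfl fun e _ => ?_)))
  all_goals ring

open Classical in
/-- The combinatorial cuts of the graph of the edges of strength at least `j`, whose ends are given
by functions `a` and `b`, are its cuts by sets of vertices. -/
theorem crossing_strength_eq [Fintype E(G)] {a b : E(G) → V(G)}
    (hab : ∀ e : E(G), G.IsLink e (a e) (b e)) (j : ℕ) {f : V(G) → Bool} {S : Set α}
    (hf : ∀ v : V(G), f v = true ↔ (v : α) ∈ S) :
    crossing a b (Finset.univ.filter fun e : E(G) => j ≤ G.strength e) f =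
      Finset.univ.filter fun e : E(G) => (e : β) ∈ G.crossingEdges S ∧ j ≤ G.strength e := by
  ext e
  have h : f (a e) ≠ f (b e) ↔ ¬((a e : α) ∈ S ↔ (b e : α) ∈ S) := by
    rw [← hf, ← hf, ne_eq, Bool.eq_iff_iff]
  simp only [mem_crossing, Finset.mem_filter, Finset.mem_univ, true_and,
    (hab e).mem_crossingEdges_iff, h]
  exact and_comm

end Graph

theorem mainTheorem2 :
    ∃ C : ℝ, 0 < C ∧
      ∀ {α β : Type*} (G : Graph α β), G.Loopless → V(G).Finite → E(G).Finite →
        ∀ (n : ℕ) (ε d ρ : ℝ) (p : β → unitInterval),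
          n = V(G).ncard → 0 < ε → ε < 1 → 0 < d →
          ρ = compressionFactor n d ε → p = G.compressionProb ρ →
          1 - (n : ℝ) ^ (-d) ≤
            (G.coinLaw p).real
              {ω | (E((G.compressed p ω).graph).ncard : ℝ) ≤ C * (n * ρ) ∧
                ∀ S : Set α, G.IsCut S →
                  (1 - ε) * G.unweighted.cutValue S ≤ (G.compressed p ω).cutValue S ∧
                  (G.compressed p ω).cutValue S ≤ (1 + ε) * G.unweighted.cutValue S} := by
  classical
  refine ⟨3, by norm_num, ?_⟩
  intro α β G hG hV hE n ε d ρ p hn hε hε1 hd hρ hp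
  have : Fintype V(G) := hV.fintype
  have : Fintype E(G) := hE.fintype
  have hprob : IsProbabilityMeasure (G.coinLaw p) := by
    unfold Graph.coinLaw
    infer_instance
  have hlog : 0 ≤ Real.log n := Real.log_natCast_nonneg n
  have hρlog : 3 * (d + 4) * Real.log n ≤ ρ := by
    rw [hρ, compressionFactor]
    exact le_div_self (by positivity) (by positivity) (by nlinarith)
  set good := {ω : E(G) → Bool | (E((G.compressed p ω).graph).ncard : ℝ) ≤ 3 * (n * ρ) ∧
                ∀ S : Set α, G.IsCut S →
                  (1 - ε) * G.unweighted.cutValue S ≤ (G.compressed p ω).cutValue S ∧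
                  (G.compressed p ω).cutValue S ≤ (1 + ε) * G.unweighted.cutValue S}
  have hρ0 : 0 ≤ ρ := le_trans (by positivity) hρlog
  -- Without edges nothing is random; this includes `n ≤ 1`, where `ρ = 0`.
  rcases E(G).eq_empty_or_nonempty with hempty | hEne
  · have : IsEmpty E(G) := by rw [hempty]; infer_instance
    have huniv : good = Set.univ := by
      refine Set.eq_univ_of_forall fun ω => ⟨?_, fun S _ => ?_⟩
      · rw [Graph.ncard_edgeSet_compressed]
        simp only [Finset.univ_eq_empty, Finset.sum_empty]
        positivity
      · rw [Graph.cutValue_compressed, Graph.cutValue_unweighted_eq_card]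
        simp [Finset.univ_eq_empty]
    rw [huniv, probReal_univ]
    have : 0 ≤ (n : ℝ) ^ (-d) := by positivity
    linarith
  have hn2 : 2 ≤ n := by
    obtain ⟨e, he⟩ := hEne
    obtain ⟨x, y, hl⟩ := Graph.exists_isLink_of_mem_edgeSet he
    rw [hn]
    exact (Set.one_lt_ncard_iff_nontrivial_and_finite.2
      ⟨⟨x, hl.left_mem, y, hl.right_mem, hl.ne⟩, hV⟩)
  have hcardV : Fintype.card V(G) = n := by rw [hn, Set.ncard_eq_toFinset_card', Set.toFinset_card]
  have hn2' : (2 : ℝ) ≤ n := by exact_mod_cast hn2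
  have hn0 : (0 : ℝ) < n := by linarith
  have hlogpos : 0 < Real.log n := Real.log_pos (by linarith)
  have hρpos : 0 < ρ := lt_of_lt_of_le (by positivity) hρlog
  have hstr : ∀ e : E(G), 1 ≤ G.strength e := fun e => Graph.one_le_strength hG hV hE e.2
  set m : E(G) → ℝ := fun e => ρ / G.strength e with hm
  have hmpos : ∀ e, 0 < m e := fun e => by
    have := hstr e
    have : (0 : ℝ) < G.strength e := by positivity
    positivity
  have hpm : ∀ e : E(G), (p e : ℝ) = min 1 (m e) := by
    intro e
    rw [hp, Graph.coe_compressionProb G hρ0]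
  choose a' b' hab' using fun e : E(G) => Graph.exists_isLink_of_mem_edgeSet e.2
  set a : E(G) → V(G) := fun e => ⟨a' e, (hab' e).left_mem⟩
  set b : E(G) → V(G) := fun e => ⟨b' e, (hab' e).right_mem⟩
  have hab : ∀ e : E(G), G.IsLink e (a e) (b e) := hab'
  set F : ℕ → Finset E(G) := fun k => Finset.univ.filter fun e : E(G) => k ≤ G.strength e with hF
  set K : Finset ℕ := Finset.univ.image fun e : E(G) => G.strength e
  set bad : Finset E(G) → Set (E(G) → Bool) := fun D => {ω | ε * ∑ e ∈ D, m e <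
        |∑ e ∈ D, m e / p e * (if ω e = true then 1 else 0) - ∑ e ∈ D, m e|}
  -- The cuts fail with probability at most `3 / 4 * n ^ (-d)`, the count with at most a quarter.
  set badCuts : Set (E(G) → Bool) := ⋃ k ∈ K, ⋃ D ∈ cutSets a b (F k), bad D
  set badCount : Set (E(G) → Bool) :=
    {ω | 3 * (n * ρ) ≤ ∑ e, (if ω e = true then (1 : ℝ) else 0)}
  have hcover : (Set.univ : Set (E(G) → Bool)) ⊆ good ∪ (badCuts ∪ badCount) := by
    intro ω _
    by_contra hω
    simp only [Set.mem_union, not_or] at hω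
    obtain ⟨hg, hcuts, hcount⟩ := hω
    refine hg ⟨?_, fun S _ => ?_⟩
    · rw [Graph.ncard_edgeSet_compressed]
      exact (not_le.1 hcount).le
    have hdev : |(G.compressed p ω).cutValue S - G.unweighted.cutValue S| ≤
        ε * G.unweighted.cutValue S := by
      refine Graph.abs_cutValue_compressed_sub_le hstr hρpos p ω S fun j D hD => ?_
      rcases D.eq_empty_or_nonempty with h0 | hne
      · simp [h0]
      -- The edges of `D` are those of strength at least `k`, for the least strength `k` in `D`.
      obtain ⟨e, heD, hmin⟩ := Finset.exists_min_image D (fun e => G.strength e) hne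
      have hDk : D = Finset.univ.filter
          (fun f : E(G) => (f : β) ∈ G.crossingEdges S ∧ G.strength e ≤ G.strength f) := by
        ext f
        refine ⟨fun hf => ?_, fun hf => ?_⟩
        · have h1 := hmin f hf
          rw [hD] at hf
          simp only [Finset.mem_filter, Finset.mem_univ, true_and] at hf ⊢
          exact ⟨hf.1, h1⟩
        · rw [hD] at heD ⊢
          simp only [Finset.mem_filter, Finset.mem_univ, true_and] at heD hf ⊢
          exact ⟨hf.1, heD.2.trans hf.2⟩
      have hDcut : D ∈ cutSets a b (F (G.strength e)) := by
        refine mem_cutSets.2 ⟨hne.ne_empty, fun v => decide ((v : α) ∈ S), ?_⟩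
        rw [hF, Graph.crossing_strength_eq hab _ (S := S) (by simp), ← hDk]
      by_contra hlt
      refine hcuts (Set.mem_biUnion (Finset.mem_image_of_mem _ (Finset.mem_univ e))
        (Set.mem_biUnion hDcut ?_))
      exact not_le.1 hlt
    have := abs_le.1 hdev
    constructor <;> linarith
  have hq : Real.exp (-(d + 2) * Real.log n) = (n : ℝ) ^ (-d) / n ^ 2 := by
    rw [Real.rpow_def_of_pos hn0, eq_div_iff (by positivity)]
    conv_lhs => rw [← Real.exp_log (show (0 : ℝ) < n ^ 2 by positivity)]
    rw [Real.log_pow, ← Real.exp_add]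
    congr 1
    push_cast
    ring
  have hlevel : ∀ k ∈ K, (G.coinLaw p).real (⋃ D ∈ cutSets a b (F k), bad D) ≤
      3 / 2 * ((n : ℝ) ^ (-d) / n ^ 2) := by
    intro k _
    refine (measureReal_biUnion_finset_le _ _).trans ?_
    have h1 : ∀ D ∈ cutSets a b (F k), 1 ≤ ∑ e ∈ D, 1 / (G.strength e : ℝ) := by
      intro D hD
      obtain ⟨h0, f, rfl⟩ := mem_cutSets.1 hD
      rw [hF, Graph.crossing_strength_eq hab _ (S := {x | ∃ h, f ⟨x, h⟩ = true}) (by simp)] at h0 ⊢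
      obtain ⟨e₀, he₀⟩ := Finset.nonempty_iff_ne_empty.2 h0
      simp only [Finset.mem_filter, Finset.mem_univ, true_and] at he₀
      exact Graph.one_le_sum_inv_strength hG hV he₀.1 he₀.2
    have hZ := sum_exp_cutSets_le (n - 1) (by omega) a b (F k)
      (fun e : E(G) => 1 / (G.strength e : ℝ)) (fun e => by positivity) h1
      (t := (d + 4) * Real.log n) (by positivity)
    rw [Nat.sub_add_cancel (by omega)] at hZ
    have hterm : ∀ D ∈ cutSets a b (F k), (G.coinLaw p).real (bad D) ≤
        2 * Real.exp (-((d + 4) * Real.log n) * ∑ e ∈ D, 1 / (G.strength e : ℝ)) := by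
      intro D _
      refine (measureReal_deviation_le (fun e : E(G) => p e) m hmpos hpm D hε hε1).trans_eq ?_
      have hε2 : ε ^ 2 / 3 * ρ = (d + 4) * Real.log n := by
        rw [hρ, compressionFactor]
        field_simp
      have hsum : ∑ e ∈ D, m e = ρ * ∑ e ∈ D, 1 / (G.strength e : ℝ) := by
        rw [Finset.mul_sum]
        exact Finset.sum_congr rfl fun e _ => by rw [hm]; ring
      rw [hsum, ← hε2]
      congr 2
      ring
    refine (Finset.sum_le_sum hterm).trans ?_
    rw [← Finset.mul_sum, ← hq]
    linarith [cutBound_le hn2 hd]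
  have hPcuts : (G.coinLaw p).real badCuts ≤ 3 / 4 * (n : ℝ) ^ (-d) := by
    refine (measureReal_biUnion_finset_le _ _).trans
      ((Finset.sum_le_card_nsmul _ _ _ hlevel).trans ?_)
    have hKc : (K.card : ℝ) ≤ n ^ 2 / 2 := by
      have h1 : K.card ≤ n.choose 2 := hcardV ▸ Graph.card_strength_le hG
      have h2 : (K.card : ℝ) ≤ (n.choose 2 : ℕ) := by exact_mod_cast h1
      rw [Nat.cast_choose_two] at h2
      nlinarith
    have hpos : 0 ≤ 3 / 2 * ((n : ℝ) ^ (-d) / n ^ 2) := by positivity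
    rw [nsmul_eq_mul]
    refine (mul_le_mul_of_nonneg_right hKc hpos).trans_eq ?_
    field_simp
    norm_num
  have hPcount : (G.coinLaw p).real badCount ≤ 1 / 4 * (n : ℝ) ^ (-d) := by
    have hsum : ∑ e : E(G), (p e : ℝ) ≤ n * ρ := by
      have h1 : ∀ e : E(G), (p e : ℝ) ≤ ρ * (1 / (G.strength e : ℝ)) := fun e => by
        rw [hpm, mul_one_div]
        exact min_le_right _ _
      have hVne : V(G).Nonempty := (Set.ncard_pos hV).1 (by omega)
      have h2 := Graph.sum_inv_strength_le hG hV hVne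
      refine (Finset.sum_le_sum fun e _ => h1 e).trans ?_
      rw [← Finset.mul_sum, mul_comm (n : ℝ), hn]
      gcongr
    refine (measureReal_count_le (fun e : E(G) => p e) (3 * (n * ρ))).trans ?_
    have h3 : Real.exp (2 * ∑ e : E(G), (p e : ℝ) - 3 * (n * ρ)) ≤
        Real.exp (-(d + 2) * Real.log n) := by
      rw [Real.exp_le_exp]
      nlinarith
    refine h3.trans ?_
    rw [hq, div_le_iff₀ (by positivity)]
    have h4 : (4 : ℝ) ≤ n ^ 2 := by nlinarith
    have h5 : (0 : ℝ) ≤ (n : ℝ) ^ (-d) := by positivity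
    nlinarith [mul_le_mul_of_nonneg_left h4 h5]
  have htotal : (1 : ℝ) ≤ (G.coinLaw p).real good + ((G.coinLaw p).real badCuts +
      (G.coinLaw p).real badCount) := by
    rw [← probReal_univ (μ := G.coinLaw p)]
    exact (measureReal_mono hcover).trans ((measureReal_union_le _ _).trans
      (add_le_add_right (measureReal_union_le _ _) _))
  linarith
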